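/- Let $\mathcal H,\mathcal K$ be complex Hilbert spaces and let $\mathcal B\subseteq B(\mathcal H)$, $\mathcal A\subseteq B(\mathcal K)$ be von Neumann algebras. Let $T:\mathcal B\to\mathcal A$ be a completely positive linear map with $T(\mathbf 1)=\mathbf 1$ that is continuous for the ultraweak ($\sigma$-weak) topologies, and put $$(X,Y):=T(X^\dagger Y)-T(X)^\dagger T(Y)\qquad (X,Y\in\mathcal B).$$ Let $B\in\mathcal B$ be Hermitian, and write $B''$ and $T(B)''$ for the von Neumann algebras generated by $B$ and by $T(B)$. Consider the statements 1. $(B,B)=0$; 2. the restriction of $T$ to $B''$ is a ${}^*$-homomorphism $B''\to T(B)''$ (in particular it takes values in $T(B)''$); 3. $(f(B),f(B))=0$ for all bounded Borel measurable functions $f:\sigma(B)\to\mathbb C$ on the spectrum of $B$, where $f(B)\in\mathcal B$ is given by the Borel functional calculus; 4. $T$ maps the relative commutant $\{X\in\mathcal B : XB=BX\}$ of $B$ into the commutant of $T(B)$. Then $(1)\Leftrightarrow(2)\Leftrightarrow(3)\Rightarrow(4)$. -/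

import Mathlib

set_option linter.unusedSimpArgs false
set_option linter.unusedSectionVars false

open MeasureTheory
open scoped CStarAlgebra CompactlySupported InnerProductSpace Topology

/-! ### Von Neumann algebras as C⋆-algebras -/

section VN

variable {H : Type*} [NormedAddCommGroup H] [InnerProductSpace ℂ H] [CompleteSpace H]

instance VonNeumannAlgebra.instSMulMemClass :
    SMulMemClass (VonNeumannAlgebra H) ℂ (H →L[ℂ] H) where
  smul_mem {s} c _ hx := s.toStarSubalgebra.smul_mem hx c

instance VonNeumannAlgebra.instIsClosed (S : VonNeumannAlgebra H) :
    IsClosed (S : Set (H →L[ℂ] H)) := by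
  rw [← S.centralizer_centralizer]
  exact Set.isClosed_centralizer _

/-- The order on `S` is the restriction of the Loewner order of operators. -/
instance VonNeumannAlgebra.instStarOrderedRing (S : VonNeumannAlgebra H) :
    StarOrderedRing S := by
  refine StarOrderedRing.of_nonneg_iff' (fun {x y} h z => ?_) (fun x => ⟨fun hx => ?_, ?_⟩)
  · change (z : H →L[ℂ] H) + x ≤ z + y
    exact add_le_add_right (show (x : H →L[ℂ] H) ≤ y from h) _
  · have hx' : 0 ≤ (x : H →L[ℂ] H) := hx
    have hmem : CFC.sqrt (x : H →L[ℂ] H) ∈ S := by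
      rw [← SetLike.mem_coe, ← S.centralizer_centralizer, Set.mem_centralizer_iff]
      intro y hy
      have hc : Commute (x : H →L[ℂ] H) y := hy _ x.2
      exact (hc.cfcₙ_nnreal NNReal.sqrt).symm
    refine ⟨⟨_, hmem⟩, Subtype.ext ?_⟩
    change (x : H →L[ℂ] H) = star (CFC.sqrt (x : H →L[ℂ] H)) * CFC.sqrt (x : H →L[ℂ] H)
    rw [(CFC.sqrt_nonneg _).isSelfAdjoint.star_eq, CFC.sqrt_mul_sqrt_self _ hx']
  · rintro ⟨s, rfl⟩
    change (0 : H →L[ℂ] H) ≤ star (s : H →L[ℂ] H) * s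
    exact star_mul_self_nonneg _

/-- `b''`: the von Neumann algebra generated by the operator `b`, as the double commutant
of `{b, star b}`. -/
noncomputable def vonNeumannGenerated (b : H →L[ℂ] H) : VonNeumannAlgebra H where
  toStarSubalgebra := StarSubalgebra.centralizer ℂ
    (StarSubalgebra.centralizer ℂ ({b} : Set (H →L[ℂ] H)) : Set (H →L[ℂ] H))
  centralizer_centralizer' := by simp [StarSubalgebra.coe_centralizer]

theorem vonNeumannGenerated_le {b : H →L[ℂ] H} (S : VonNeumannAlgebra H) (hb : b ∈ S) :
    vonNeumannGenerated b ≤ S := by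
  intro x hx
  have hx' : x ∈ (({b} : Set (H →L[ℂ] H)) ∪ star {b}).centralizer.centralizer := by
    rw [← StarSubalgebra.coe_centralizer_centralizer ℂ]
    exact hx
  rw [← SetLike.mem_coe, ← S.centralizer_centralizer]
  refine Set.centralizer_subset (Set.centralizer_subset ?_) hx'
  rintro y (rfl | hy)
  · exact hb
  · have : star y = b := by simpa using hy
    rw [← star_star y, this]
    exact star_mem hb

end VN

/-! ### The ultraweak topology -/

section Ultraweak

variable {H K : Type*} [NormedAddCommGroup H] [InnerProductSpace ℂ H] [CompleteSpace H]
  [NormedAddCommGroup K] [InnerProductSpace ℂ K] [CompleteSpace K]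

/-- The ultraweak (σ-weak) topology on the bounded operators on `H`: the coarsest topology for
which all functionals `a ↦ ∑ₙ ⟪xₙ, a yₙ⟫` with `∑ ‖xₙ‖² < ∞`, `∑ ‖yₙ‖² < ∞` are continuous. -/
@[reducible]
noncomputable def ultraweakTopology (H : Type*) [NormedAddCommGroup H] [InnerProductSpace ℂ H] :
    TopologicalSpace (H →L[ℂ] H) :=
  ⨅ p : lp (fun _ : ℕ => H) 2 × lp (fun _ : ℕ => H) 2,
    TopologicalSpace.induced (fun a : H →L[ℂ] H => ∑' n, ⟪p.1 n, a (p.2 n)⟫_ℂ) inferInstance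

/-- Continuity of a map between von Neumann algebras for their ultraweak topologies. -/
def IsUltraweaklyContinuous {S : VonNeumannAlgebra H} {R : VonNeumannAlgebra K}
    (T : S → R) : Prop :=
  Continuous[TopologicalSpace.induced Subtype.val (ultraweakTopology H),
    TopologicalSpace.induced Subtype.val (ultraweakTopology K)] T

end Ultraweak

/-! ### Bounded Borel functional calculus of a self-adjoint operator -/

section Borel

variable {H : Type*} [NormedAddCommGroup H] [InnerProductSpace ℂ H] [CompleteSpace H]
  {b : H →L[ℂ] H}

/-- The positive functional `g ↦ ⟪x, g(b) x⟫` on the continuous functions on the spectrum. -/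
noncomputable def vectorFunctional (hb : IsSelfAdjoint b) (x : H) :
    C_c(spectrum ℝ b, ℝ) →ₚ[ℝ] ℝ :=
  PositiveLinearMap.mk₀
    { toFun := fun g => (⟪x, cfcHom hb g.toContinuousMap x⟫_ℂ).re
      map_add' := fun g h => by
        have : (g + h).toContinuousMap = g.toContinuousMap + h.toContinuousMap := rfl
        simp [this]
      map_smul' := fun c g => by
        have : (c • g).toContinuousMap = c • g.toContinuousMap := rfl
        rw [this, map_smul]
        simp [inner_smul_right_eq_smul] }
    (fun g hg => by
      have h : 0 ≤ cfcHom hb g.toContinuousMap := (cfcHom_nonneg_iff hb).2 fun t => hg t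
      exact ((ContinuousLinearMap.nonneg_iff_isPositive _).1 h).re_inner_nonneg_right x)

/-- The spectral measure `μₓ` of `b` in the vector `x`, a measure on the spectrum of `b`: it is
determined by `∫ g dμₓ = ⟪x, g(b) x⟫` for continuous `g`. -/
noncomputable def vectorMeasure (hb : IsSelfAdjoint b) (x : H) : Measure (spectrum ℝ b) :=
  RealRMK.rieszMeasure (vectorFunctional hb x)

instance (hb : IsSelfAdjoint b) (x : H) : IsFiniteMeasure (vectorMeasure hb x) := by
  unfold vectorMeasure; infer_instance

theorem integral_vectorMeasure (hb : IsSelfAdjoint b) (x : H) (g : C(spectrum ℝ b, ℝ)) :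
    ((∫ t, g t ∂(vectorMeasure hb x) : ℝ) : ℂ) = ⟪x, cfcHom hb g x⟫_ℂ := by
  have h := RealRMK.integral_rieszMeasure (vectorFunctional hb x)
    (CompactlySupportedContinuousMap.continuousMapEquiv g)
  have h' : ∫ t, g t ∂(vectorMeasure hb x) = (⟪x, cfcHom hb g x⟫_ℂ).re := h
  have hs : IsSelfAdjoint (cfcHom hb g) := cfcHom_predicate hb g
  have hsym := hs.isSymmetric
  rw [h']
  refine Complex.conj_eq_iff_re.1 ?_
  rw [inner_conj_symm]
  exact hsym x x

theorem integral_vectorMeasure_complex (hb : IsSelfAdjoint b) (x : H)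
    (g : C(spectrum ℝ b, ℂ)) :
    ∫ t, g t ∂(vectorMeasure hb x) =
      ⟪x, cfcHom hb ⟨fun t => (g t).re, by fun_prop⟩ x⟫_ℂ +
        Complex.I * ⟪x, cfcHom hb ⟨fun t => (g t).im, by fun_prop⟩ x⟫_ℂ := by
  have hg : Integrable g (vectorMeasure hb x) :=
    (map_continuous g).integrable_of_hasCompactSupport (HasCompactSupport.of_compactSpace _)
  rw [← integral_vectorMeasure, ← integral_vectorMeasure, ← integral_re_add_im hg, mul_comm]
  rfl

/-- A linear relation between vector functionals of `b` that holds on continuous functions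
extends to bounded Borel functions. -/
theorem vectorMeasure_relation (hb : IsSelfAdjoint b) (l : List (ℂ × H))
    (hl : ∀ a : H →L[ℂ] H, (∀ y : H →L[ℂ] H, Commute b y → Commute a y) →
      (l.map fun p => p.1 * ⟪p.2, a p.2⟫_ℂ).sum = 0)
    {f : spectrum ℝ b → ℂ} (hf : Measurable f) (hfb : ∃ M, ∀ t, ‖f t‖ ≤ M) :
    (l.map fun p => p.1 * ∫ t, f t ∂(vectorMeasure hb p.2)).sum = 0 := by
  obtain ⟨M, hM⟩ := hfb
  have hint : ∀ μ : Measure (spectrum ℝ b), IsFiniteMeasure μ → Integrable f μ := fun μ _ =>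
    Integrable.of_bound hf.aestronglyMeasurable M (ae_of_all _ hM)
  set μ : Measure (spectrum ℝ b) := (l.map fun p => vectorMeasure hb p.2).sum with hμ
  have hle : ∀ p ∈ l, vectorMeasure hb p.2 ≤ μ := fun p hp =>
    by
    obtain ⟨k₁, k₂, rfl⟩ := List.append_of_mem hp
    rw [hμ, List.map_append, List.map_cons, List.sum_append, List.sum_cons]
    exact Measure.le_add_left (Measure.le_add_right le_rfl)
  have hfin : IsFiniteMeasure μ := by
    have : ∀ k : List (ℂ × H), IsFiniteMeasure (k.map fun p => vectorMeasure hb p.2).sum := by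
      intro k
      induction k with
      | nil => simpa using (inferInstance : IsFiniteMeasure (0 : Measure (spectrum ℝ b)))
      | cons p k ih => simpa using (inferInstance : IsFiniteMeasure
          (vectorMeasure hb p.2 + (k.map fun p => vectorMeasure hb p.2).sum))
    exact this l
  set C : ℝ := (l.map fun p => ‖p.1‖).sum with hC
  have hC0 : 0 ≤ C := List.sum_nonneg (by
    intro r hr
    obtain ⟨p, _, rfl⟩ := List.mem_map.1 hr
    exact norm_nonneg _)
  have key : ∀ ε > 0, ‖(l.map fun p => p.1 * ∫ t, f t ∂(vectorMeasure hb p.2)).sum‖ ≤ C * ε := by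
    intro ε hε
    obtain ⟨g, hg, hgi⟩ := (hint μ hfin).exists_boundedContinuous_integral_sub_le hε
    have h0 : (l.map fun p => p.1 * ∫ t, g t ∂(vectorMeasure hb p.2)).sum = 0 := by
      have hcomm : ∀ (u : C(spectrum ℝ b, ℝ)) (y : H →L[ℂ] H), Commute b y →
          Commute (cfcHom hb u) y := fun u y hy => hb.commute_cfcHom hb hy u
      have h1 := hl _ (hcomm ⟨fun t => (g t).re, by fun_prop⟩)
      have h2 := hl _ (hcomm ⟨fun t => (g t).im, by fun_prop⟩)
      calc _ = (l.map fun p =>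
              p.1 * ⟪p.2, cfcHom hb ⟨fun t => (g t).re, by fun_prop⟩ p.2⟫_ℂ +
              Complex.I *
                (p.1 * ⟪p.2, cfcHom hb ⟨fun t => (g t).im, by fun_prop⟩ p.2⟫_ℂ)).sum := by
            congr 2
            funext p
            rw [show ∫ t, g t ∂(vectorMeasure hb p.2) = _ from
              integral_vectorMeasure_complex hb p.2 g.toContinuousMap]
            simp only [mul_add, mul_left_comm]
            rfl
        _ = 0 := by
            rw [List.sum_map_add, List.sum_map_mul_left, h1, h2]
            simp
    have hterm : ∀ k : List (ℂ × H), (∀ p ∈ k, vectorMeasure hb p.2 ≤ μ) →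
        ‖(k.map fun p => p.1 * ∫ t, f t ∂(vectorMeasure hb p.2)).sum -
          (k.map fun p => p.1 * ∫ t, g t ∂(vectorMeasure hb p.2)).sum‖ ≤
          (k.map fun p => ‖p.1‖).sum * ε := by
      intro k hk
      induction k with
      | nil => simp
      | cons p k ih =>
        have ih' := ih fun q hq => hk q (List.mem_cons_of_mem _ hq)
        have hp := hk p List.mem_cons_self
        have hd : ‖∫ t, f t ∂(vectorMeasure hb p.2) - ∫ t, g t ∂(vectorMeasure hb p.2)‖ ≤ ε := by
          rw [← integral_sub (hint _ inferInstance) (hgi.mono_measure hp)]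
          refine (norm_integral_le_integral_norm _).trans (le_trans ?_ hg)
          exact integral_mono_measure hp (ae_of_all _ fun _ => norm_nonneg _)
            ((hint μ hfin).sub hgi).norm
        simp only [List.map_cons, List.sum_cons]
        rw [add_sub_add_comm, ← mul_sub, add_mul]
        refine (norm_add_le _ _).trans (add_le_add ?_ ih')
        rw [norm_mul]
        gcongr
    simpa [h0] using hterm l hle
  have : ‖(l.map fun p => p.1 * ∫ t, f t ∂(vectorMeasure hb p.2)).sum‖ ≤ 0 := by
    refine le_of_forall_pos_le_add fun ε hε => ?_
    refine (key (ε / (C + 1)) (by positivity)).trans ?_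
    rw [zero_add, mul_div_assoc', div_le_iff₀ (by positivity)]
    nlinarith
  exact norm_le_zero_iff.1 this

/-- The coefficients and vectors of the polarization identity. -/
noncomputable def polarizationList (x y : H) : List (ℂ × H) :=
  [(1 / 4, x + y), (-1 / 4, x - y), (-Complex.I / 4, x + Complex.I • y),
    (Complex.I / 4, x - Complex.I • y)]

theorem polarizationList_inner (a : H →L[ℂ] H) (x y : H) :
    ((polarizationList x y).map fun p => p.1 * ⟪p.2, a p.2⟫_ℂ).sum = ⟪x, a y⟫_ℂ := by
  have hI : Complex.I * Complex.I = -1 := Complex.I_mul_I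
  simp only [polarizationList, List.map_cons, List.map_nil, List.sum_cons, List.sum_nil,
    map_add, map_sub, map_smul, inner_add_left, inner_add_right, inner_sub_left,
    inner_sub_right, inner_smul_left, inner_smul_right, Complex.conj_I]
  linear_combination (⟪y, a x⟫_ℂ / 2 - ⟪x, a y⟫_ℂ / 2) * hI

/-- The sesquilinear form `⟪x, f(b) y⟫`, obtained from the spectral measures by polarization. -/
noncomputable def borelForm (hb : IsSelfAdjoint b) (f : spectrum ℝ b → ℂ) (x y : H) : ℂ :=
  ((polarizationList x y).map fun p => p.1 * ∫ t, f t ∂(vectorMeasure hb p.2)).sum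

theorem borelForm_relation (hb : IsSelfAdjoint b) (k : List (ℂ × H × H))
    (hk : ∀ a : H →L[ℂ] H, (∀ y : H →L[ℂ] H, Commute b y → Commute a y) →
      (k.map fun p => p.1 * ⟪p.2.1, a p.2.2⟫_ℂ).sum = 0)
    {f : spectrum ℝ b → ℂ} (hf : Measurable f) (hfb : ∃ M, ∀ t, ‖f t‖ ≤ M) :
    (k.map fun p => p.1 * borelForm hb f p.2.1 p.2.2).sum = 0 := by
  let L : List (ℂ × H × H) → List (ℂ × H) := fun k =>
    k.flatMap fun p => (polarizationList p.2.1 p.2.2).map fun q => (p.1 * q.1, q.2)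
  have hL : ∀ (w : H → ℂ) (k : List (ℂ × H × H)),
      ((L k).map fun p => p.1 * w p.2).sum =
        (k.map fun p => p.1 * ((polarizationList p.2.1 p.2.2).map fun q => q.1 * w q.2).sum).sum := by
    intro w k
    induction k with
    | nil => rfl
    | cons p k ih =>
      simp only [L, List.flatMap_cons, List.map_append, List.sum_append, List.map_cons,
        List.sum_cons] at ih ⊢
      rw [ih, List.map_map, ← List.sum_map_mul_left]
      congr 3
      funext q
      simp [mul_assoc]
  have h := vectorMeasure_relation hb (L k) (fun a ha => ?_) hf hfb
  · rw [hL fun x => ∫ t, f t ∂(vectorMeasure hb x)] at h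
    exact h
  · rw [hL fun x => ⟪x, a x⟫_ℂ]
    simp only [polarizationList_inner]
    exact hk a ha

theorem borelForm_self (hb : IsSelfAdjoint b) {f : spectrum ℝ b → ℂ} (hf : Measurable f)
    (hfb : ∃ M, ∀ t, ‖f t‖ ≤ M) (x : H) :
    borelForm hb f x x = ∫ t, f t ∂(vectorMeasure hb x) := by
  have h := vectorMeasure_relation hb ((-1, x) :: polarizationList x x) (fun a _ => ?_) hf hfb
  · rw [List.map_cons, List.sum_cons] at h
    change -1 * _ + borelForm hb f x x = 0 at h
    linear_combination h
  · rw [List.map_cons, List.sum_cons, polarizationList_inner]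
    ring

theorem norm_borelForm_le (hb : IsSelfAdjoint b) {f : spectrum ℝ b → ℂ} {M : ℝ}
    (hM : ∀ t, ‖f t‖ ≤ M) (x y : H) :
    ‖borelForm hb f x y‖ ≤ M * (‖x‖ ^ 2 + ‖y‖ ^ 2) := by
  have hq : ∀ z : H, ‖∫ t, f t ∂(vectorMeasure hb z)‖ ≤ M * ‖z‖ ^ 2 := by
    intro z
    have h1 : (vectorMeasure hb z).real Set.univ = ‖z‖ ^ 2 := by
      have h := integral_vectorMeasure hb z 1
      simp only [ContinuousMap.one_apply, integral_const, smul_eq_mul, mul_one, map_one,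
        one_apply_eq_self, inner_self_eq_norm_sq_to_K] at h
      exact Complex.ofReal_injective (h.trans (by push_cast; rfl))
    rw [← h1]
    exact norm_integral_le_of_norm_le_const (ae_of_all _ hM)
  have hpar : ∀ z : H, ‖x + z‖ ^ 2 + ‖x - z‖ ^ 2 = 2 * (‖x‖ ^ 2 + ‖z‖ ^ 2) := fun z => by
    have := parallelogram_law_with_norm ℂ x z
    nlinarith
  have h1 := hpar y
  have h2 := hpar (Complex.I • y)
  rw [norm_smul, Complex.norm_I, one_mul] at h2
  simp only [borelForm, polarizationList, List.map_cons, List.map_nil, List.sum_cons,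
    List.sum_nil, add_zero]
  have hn : ∀ (c : ℂ) (z : H), ‖c‖ = 1 / 4 →
      ‖c * ∫ t, f t ∂(vectorMeasure hb z)‖ ≤ 1 / 4 * (M * ‖z‖ ^ 2) := fun c z hc => by
    rw [norm_mul, hc]
    gcongr
    exact hq z
  refine (norm_add_le _ _).trans ((add_le_add (hn _ _ (by simp)) ((norm_add_le _ _).trans
    (add_le_add (hn _ _ (by simp)) ((norm_add_le _ _).trans (add_le_add (hn _ _ (by simp))
      (hn _ _ (by simp))))))).trans (le_of_eq ?_))
  linear_combination (M / 4) * h1 + (M / 4) * h2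

theorem exists_borelFunction (hb : IsSelfAdjoint b) {f : spectrum ℝ b → ℂ} (hf : Measurable f)
    (hfb : ∃ M, ∀ t, ‖f t‖ ≤ M) :
    ∃ c : H →L[ℂ] H, ∀ x y, ⟪x, c y⟫_ℂ = borelForm hb f x y := by
  have hal : ∀ x x' y, borelForm hb f (x + x') y = borelForm hb f x y + borelForm hb f x' y := by
    intro x x' y
    have := borelForm_relation hb [(1, x + x', y), (-1, x, y), (-1, x', y)]
      (fun a _ => by
        simp only [List.map_cons, List.map_nil, List.sum_cons, List.sum_nil, map_add, map_smul,
          inner_add_left, inner_add_right, inner_smul_left, inner_smul_right]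
        ring) hf hfb
    simp only [List.map_cons, List.map_nil, List.sum_cons, List.sum_nil] at this
    linear_combination this
  have har : ∀ x y y', borelForm hb f x (y + y') = borelForm hb f x y + borelForm hb f x y' := by
    intro x y y'
    have := borelForm_relation hb [(1, x, y + y'), (-1, x, y), (-1, x, y')]
      (fun a _ => by
        simp only [List.map_cons, List.map_nil, List.sum_cons, List.sum_nil, map_add, map_smul,
          inner_add_left, inner_add_right, inner_smul_left, inner_smul_right]
        ring) hf hfb
    simp only [List.map_cons, List.map_nil, List.sum_cons, List.sum_nil] at this
    linear_combination this
  have hsl : ∀ (c : ℂ) x y, borelForm hb f (c • x) y = starRingEnd ℂ c * borelForm hb f x y := by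
    intro c x y
    have := borelForm_relation hb [(1, c • x, y), (-starRingEnd ℂ c, x, y)]
      (fun a _ => by
        simp only [List.map_cons, List.map_nil, List.sum_cons, List.sum_nil, map_add, map_smul,
          inner_add_left, inner_add_right, inner_smul_left, inner_smul_right]
        ring) hf hfb
    simp only [List.map_cons, List.map_nil, List.sum_cons, List.sum_nil] at this
    linear_combination this
  have hsr : ∀ (c : ℂ) x y, borelForm hb f x (c • y) = c * borelForm hb f x y := by
    intro c x y
    have := borelForm_relation hb [(1, x, c • y), (-c, x, y)]
      (fun a _ => by
        simp only [List.map_cons, List.map_nil, List.sum_cons, List.sum_nil, map_add, map_smul,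
          inner_add_left, inner_add_right, inner_smul_left, inner_smul_right]
        ring) hf hfb
    simp only [List.map_cons, List.map_nil, List.sum_cons, List.sum_nil] at this
    linear_combination this
  obtain ⟨M, hM⟩ := hfb
  let B : H →ₗ⋆[ℂ] H →ₗ[ℂ] ℂ := LinearMap.mk₂'ₛₗ (starRingEnd ℂ) (RingHom.id ℂ)
    (borelForm hb f) hal hsl har hsr
  have hbound : ∀ x y, ‖B x y‖ ≤ (2 * M) * ‖x‖ * ‖y‖ := by
    intro x y
    rcases eq_or_ne x 0 with rfl | hx
    · simp
    rcases eq_or_ne y 0 with rfl | hy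
    · simp
    have hx' : ‖x‖ ≠ 0 := norm_ne_zero_iff.2 hx
    have hy' : ‖y‖ ≠ 0 := norm_ne_zero_iff.2 hy
    have h := norm_borelForm_le hb hM ((‖x‖⁻¹ : ℂ) • x) ((‖y‖⁻¹ : ℂ) • y)
    rw [hsl, hsr, norm_mul, norm_mul, norm_smul, norm_smul] at h
    simp only [RCLike.norm_conj, norm_inv, Complex.norm_real, norm_norm, inv_mul_cancel₀ hx',
      inv_mul_cancel₀ hy'] at h
    change ‖borelForm hb f x y‖ ≤ _
    calc ‖borelForm hb f x y‖
        = (‖x‖⁻¹ * (‖y‖⁻¹ * ‖borelForm hb f x y‖)) * (‖x‖ * ‖y‖) := by field_simp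
      _ ≤ (M * (1 ^ 2 + 1 ^ 2)) * (‖x‖ * ‖y‖) := by gcongr
      _ = _ := by ring
  refine ⟨(InnerProductSpace.continuousLinearMapOfBilin (B.mkContinuous₂ (2 * M) hbound)).adjoint,
    fun x y => ?_⟩
  rw [ContinuousLinearMap.adjoint_inner_right,
    InnerProductSpace.continuousLinearMapOfBilin_apply]
  rfl

/-- The bounded operator `f(b)`, for `b` self-adjoint and `f` a bounded Borel function on the
spectrum of `b`; it is determined by `⟪x, f(b) x⟫ = ∫ f dμₓ` for all `x`. -/
noncomputable def borelFunction (hb : IsSelfAdjoint b) (f : spectrum ℝ b → ℂ) (hf : Measurable f)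
    (hfb : ∃ M, ∀ t, ‖f t‖ ≤ M) : H →L[ℂ] H :=
  (exists_borelFunction hb hf hfb).choose

theorem inner_borelFunction (hb : IsSelfAdjoint b) {f : spectrum ℝ b → ℂ} (hf : Measurable f)
    (hfb : ∃ M, ∀ t, ‖f t‖ ≤ M) (x : H) :
    ⟪x, borelFunction hb f hf hfb x⟫_ℂ = ∫ t, f t ∂(vectorMeasure hb x) :=
  ((exists_borelFunction hb hf hfb).choose_spec x x).trans (borelForm_self hb hf hfb x)

theorem commute_borelFunction (hb : IsSelfAdjoint b) {f : spectrum ℝ b → ℂ} (hf : Measurable f)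
    (hfb : ∃ M, ∀ t, ‖f t‖ ≤ M) {y : H →L[ℂ] H} (hy : Commute b y) :
    Commute (borelFunction hb f hf hfb) y := by
  have hspec := (exists_borelFunction hb hf hfb).choose_spec
  refine ContinuousLinearMap.ext fun v => ext_inner_left ℂ fun u => ?_
  simp only [mul_apply_eq_comp]
  rw [← ContinuousLinearMap.adjoint_inner_left y]
  rw [borelFunction, hspec, hspec]
  have := borelForm_relation hb [(1, u, y v), (-1, y.adjoint u, v)]
    (fun a ha => by
      have h : a (y v) = y (a v) := DFunLike.congr_fun (ha y hy).eq v
      simp [ContinuousLinearMap.adjoint_inner_left, h]) hf hfb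
  simp only [List.map_cons, List.map_nil, List.sum_cons, List.sum_nil] at this
  linear_combination this

theorem borelFunction_mem (S : VonNeumannAlgebra H) (hS : b ∈ S) (hb : IsSelfAdjoint b)
    {f : spectrum ℝ b → ℂ} (hf : Measurable f) (hfb : ∃ M, ∀ t, ‖f t‖ ≤ M) :
    borelFunction hb f hf hfb ∈ S := by
  rw [← SetLike.mem_coe, ← S.centralizer_centralizer, Set.mem_centralizer_iff]
  intro y hy
  exact (commute_borelFunction hb hf hfb (hy b hS)).eq.symm

end Borel

/-! ### Zero added variance -/

section AddedVariance

variable {H K : Type*} [NormedAddCommGroup H] [InnerProductSpace ℂ H] [CompleteSpace H]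
  [NormedAddCommGroup K] [InnerProductSpace ℂ K] [CompleteSpace K]
  {𝓑 : VonNeumannAlgebra H} {𝓐 : VonNeumannAlgebra K}

/-- The operator-valued form `(X, Y) = T(X† Y) - T(X)† T(Y)`. -/
noncomputable def varianceForm (T : 𝓑 →CP 𝓐) (X Y : 𝓑) : 𝓐 :=
  T (star X * Y) - star (T X) * T Y

/-- The restriction of `T` to `B''` is a (unital) ⋆-homomorphism from `B''` to `T(B)''`. -/
def RestrictsToStarHom (T : 𝓑 →CP 𝓐) (B : 𝓑) : Prop :=
  ∃ φ : vonNeumannGenerated (B : H →L[ℂ] H) →⋆ₐ[ℂ] vonNeumannGenerated (T B : K →L[ℂ] K),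
    ∀ x : vonNeumannGenerated (B : H →L[ℂ] H),
      (φ x : K →L[ℂ] K) = T ⟨x, vonNeumannGenerated_le 𝓑 B.2 x.2⟩

/-- `f(B)` as an element of the von Neumann algebra containing `B`. -/
noncomputable def applyBorel (B : 𝓑) (hB : IsSelfAdjoint (B : H →L[ℂ] H))
    (f : spectrum ℝ (B : H →L[ℂ] H) → ℂ) (hf : Measurable f) (hfb : ∃ M, ∀ t, ‖f t‖ ≤ M) : 𝓑 :=
  ⟨borelFunction hB f hf hfb, borelFunction_mem 𝓑 B.2 hB hf hfb⟩

end AddedVariance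

/-! ### The Kadison–Schwarz inequality and the multiplicative domain -/

section KadisonSchwarz

namespace CStarMatrix

variable {A : Type*} [CStarAlgebra A] [PartialOrder A] [StarOrderedRing A]

/-! The proof is a multiplicative-domain argument. Complete positivity and unitality give the
Kadison–Schwarz inequality, so `varianceForm` is a positive semidefinite operator-valued form. As
for any such form, a null vector is orthogonal to everything: (B,B) = 0 forces T(BY) = T(B)T(Y) for
every Y, and, taking adjoints, T(YB) = T(Y)T(B). Statement (4) follows at once, and iteration gives
T(q(B)Y) = q(T(B))T(Y) for polynomials q.

The step from polynomials to B'' uses normality of T. Polynomials in B are ultraweakly dense in B''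
(`mem_ultraweak_closure_aeval`), and the matrix coefficients of T(XY) and of T(X)T(Y) are
ultraweakly continuous in X for fixed Y, so multiplicativity extends to X in B''. The same argument
shows that T(X) commutes with the commutant of T(B), hence lies in T(B)''.

Conversely, a ⋆-homomorphism annihilates the form on B''. Every f(B) lies there, which gives (3);
the choice f(t) = t returns (1). -/

theorem isSelfAdjoint_apply_of_nonneg {n : Type*} [Fintype n] [DecidableEq n]
    {M : CStarMatrix n n A} (hM : 0 ≤ M) (i j : n) : star (M i j) = M j i := by
  have h := (IsSelfAdjoint.of_nonneg hM).star_eq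
  calc star (M i j) = (star M) j i := rfl
    _ = M j i := by rw [h]

/-- Positive matrices are sums of matrices `star R * R`, and for one of these the form is the sum
over k of `star (R w)ₖ * (R w)ₖ`. -/
theorem sum_star_mul_mul_nonneg {n : Type*} [Fintype n] [DecidableEq n]
    {M : CStarMatrix n n A} (hM : 0 ≤ M) (w : n → A) :
    0 ≤ ∑ i, ∑ j, star (w i) * M i j * w j := by
  rw [StarOrderedRing.nonneg_iff] at hM
  induction hM using AddSubmonoid.closure_induction with
  | zero => simp
  | add M N _ _ hM hN => simpa [mul_add, add_mul, Finset.sum_add_distrib] using add_nonneg hM hN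
  | mem M hM =>
  obtain ⟨R, rfl⟩ := hM
  have : ∑ i, ∑ j, star (w i) * (star R * R) i j * w j =
      ∑ k, star (∑ i, R k i * w i) * ∑ j, R k j * w j := by
    have hentry : ∀ i j, (star R * R) i j = ∑ k, star (R k i) * R k j := fun i j => by
      rw [CStarMatrix.mul_apply]
      rfl
    simp only [hentry, Finset.mul_sum, Finset.sum_mul, star_sum, star_mul, mul_assoc]
    calc ∑ i, ∑ j, ∑ k, star (w i) * (star (R k i) * (R k j * w j))
        = ∑ i, ∑ k, ∑ j, star (w i) * (star (R k i) * (R k j * w j)) :=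
          Finset.sum_congr rfl fun i _ => Finset.sum_comm
      _ = ∑ k, ∑ i, ∑ j, star (w i) * (star (R k i) * (R k j * w j)) := Finset.sum_comm
      _ = _ := Finset.sum_congr rfl fun k _ => Finset.sum_comm
  rw [this]
  exact Finset.sum_nonneg fun k _ => star_mul_self_nonneg _

/-- The Gram matrix of the row (1, a). Its image under T encodes both the compatibility of T with
adjoints and the Schwarz inequality. -/
theorem star_mul_self_two_nonneg (a : A) :
    0 ≤ (ofMatrix !![1, a; star a, star a * a] : CStarMatrix (Fin 2) (Fin 2) A) := by
  have : (ofMatrix !![1, a; star a, star a * a] : CStarMatrix (Fin 2) (Fin 2) A) =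
      star (ofMatrix !![1, a; 0, 0]) * ofMatrix !![1, a; 0, 0] := by
    ext i j
    rw [CStarMatrix.mul_apply, Fin.sum_univ_two]
    fin_cases i <;> fin_cases j <;> simp [CStarMatrix.star_apply]
  rw [this]
  exact star_mul_self_nonneg _

end CStarMatrix

namespace CompletelyPositiveMap

variable {A₁ A₂ : Type*} [CStarAlgebra A₁] [CStarAlgebra A₂] [PartialOrder A₁] [PartialOrder A₂]
  [StarOrderedRing A₁] [StarOrderedRing A₂]

theorem map_star_apply (T : A₁ →CP A₂) (a : A₁) : T (star a) = star (T a) :=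
  (CStarMatrix.isSelfAdjoint_apply_of_nonneg
    (T.map_cstarMatrix_nonneg _ (CStarMatrix.star_mul_self_two_nonneg a)) 0 1).symm

/-- The Kadison–Schwarz inequality. -/
theorem star_map_mul_map_le (T : A₁ →CP A₂) (hT : T 1 = 1) (a : A₁) :
    star (T a) * T a ≤ T (star a * a) := by
  -- Since T 1 = 1, the vector (-T a, 1) completes the square: the form takes the value T(a†a) -
  -- T(a)†T(a).
  have h := CStarMatrix.sum_star_mul_mul_nonneg
    (T.map_cstarMatrix_nonneg _ (CStarMatrix.star_mul_self_two_nonneg a)) ![-T a, 1]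
  simp [Fin.sum_univ_two, hT, map_star_apply] at h
  exact h

end CompletelyPositiveMap

/-- In an ordered C⋆-algebra, an element all of whose real multiples are bounded above by a fixed
element vanishes. -/
theorem eq_zero_of_forall_smul_le {A : Type*} [CStarAlgebra A] [PartialOrder A]
    [StarOrderedRing A] {c d : A} (h : ∀ t : ℝ, t • c ≤ d) : c = 0 := by
  have key : ∀ e : A, (∀ t : ℝ, t • e ≤ d) → e ≤ 0 := by
    intro e he
    have hlim : Filter.Tendsto (fun n : ℕ => ((n : ℝ) + 1)⁻¹ • d) Filter.atTop (𝓝 0) := by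
      have := (tendsto_one_div_add_atTop_nhds_zero_nat (𝕜 := ℝ)).smul_const d
      simpa using this
    refine ge_of_tendsto' hlim fun n => ?_
    have hn : (0 : ℝ) < (n : ℝ) + 1 := by positivity
    have := smul_le_smul_of_nonneg_left (he ((n : ℝ) + 1)) (inv_nonneg.2 hn.le)
    rwa [inv_smul_smul₀ hn.ne'] at this
  refine le_antisymm (key c h) (neg_nonpos.1 (key (-c) fun t => ?_))
  simpa using h (-t)

namespace CompletelyPositiveMap

variable {A₁ A₂ : Type*} [CStarAlgebra A₁] [CStarAlgebra A₂] [PartialOrder A₁] [PartialOrder A₂]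
  [StarOrderedRing A₁] [StarOrderedRing A₂]

/-- Cauchy–Schwarz degeneracy: an element with zero added variance is orthogonal to everything. -/
theorem map_star_mul_of_variance_eq_zero (T : A₁ →CP A₂) (hT : T 1 = 1) {a : A₁}
    (ha : T (star a * a) = star (T a) * T a) (y : A₁) :
    T (star a * y) = star (T a) * T y := by
  -- In the Schwarz inequality for z - t a the t² term vanishes by `ha`. What remains is affine in
  -- the real parameter t and nonnegative for all t, so its slope is zero.
  have hsym : ∀ z : A₁, T (star a * z) - star (T a) * T z +
      star (T (star a * z) - star (T a) * T z) = 0 := by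
    intro z
    refine eq_zero_of_forall_smul_le (d := T (star z * z) - star (T z) * T z) fun t => ?_
    have h := T.star_map_mul_map_le hT (z - (t : ℂ) • a)
    rw [← sub_nonneg] at h ⊢
    convert h using 1
    have hstar : T (star z * a) = star (T (star a * z)) := by
      rw [← map_star_apply]
      simp
    simp only [star_sub, star_smul, sub_mul, mul_sub, map_sub, map_smul, smul_mul_assoc,
      mul_smul_comm, ha, hstar, RCLike.star_def, Complex.conj_ofReal, star_mul, star_star]
    rw [← Complex.coe_smul]
    simp only [smul_add, smul_sub]
    abel
  have h1 := hsym y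
  -- `h1` kills the real part of the defect; rotating y by i kills the imaginary part.
  have h2 := hsym (Complex.I • y)
  simp only [mul_smul_comm, map_smul, ← smul_sub, star_smul, RCLike.star_def, Complex.conj_I,
    neg_smul] at h2
  set v := T (star a * y) - star (T a) * T y with hv
  have h3 : Complex.I • (v - star v) = 0 := by
    rw [smul_sub, sub_eq_add_neg]
    exact h2
  have h4 : v - star v = 0 := (smul_eq_zero.1 h3).resolve_left Complex.I_ne_zero
  have h5 : (2 : ℂ) • v = 0 := by
    rw [two_smul]
    calc v + v = (v + star v) + (v - star v) := by abel
      _ = 0 := by rw [h1, h4, add_zero]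
  exact sub_eq_zero.1 ((smul_eq_zero.1 h5).resolve_left two_ne_zero)

end CompletelyPositiveMap

end KadisonSchwarz

/-! ### Amplifications and the density theorem -/

section Density

variable {H : Type*} [NormedAddCommGroup H] [InnerProductSpace ℂ H]

/-- The diagonal action of an operator on square-summable families. -/
noncomputable def amplification (ι : Type*) :
    (H →L[ℂ] H) →ₐ[ℂ] (lp (fun _ : ι => H) 2 →L[ℂ] lp (fun _ : ι => H) 2) where
  toFun a := lp.mapCLM 2 (fun _ : ι => a) (norm_nonneg a) fun _ => le_rfl
  map_one' := by ext; rfl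
  map_mul' _ _ := by ext; rfl
  map_zero' := by ext; rfl
  map_add' _ _ := by ext; rfl
  commutes' _ := by ext; rfl

@[simp]
theorem amplification_apply {ι : Type*} (a : H →L[ℂ] H) (y : lp (fun _ : ι => H) 2) (i : ι) :
    amplification ι a y i = a (y i) := rfl

theorem amplification_single {ι : Type*} [DecidableEq ι] (a : H →L[ℂ] H) (i : ι) (v : H) :
    amplification ι a (lp.single 2 i v) = lp.single 2 i (a v) := by
  ext j
  rw [amplification_apply]
  rcases eq_or_ne j i with rfl | hj
  · simp
  · simp [hj]

theorem aeval_amplification {ι : Type*} (b : H →L[ℂ] H) (q : Polynomial ℂ) :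
    Polynomial.aeval (amplification ι b) q = amplification ι (Polynomial.aeval b q) :=
  Polynomial.aeval_algHom_apply _ _ _

theorem isSelfAdjoint_amplification [CompleteSpace H] {ι : Type*} {b : H →L[ℂ] H}
    (hb : IsSelfAdjoint b) : IsSelfAdjoint (amplification ι b) := by
  rw [ContinuousLinearMap.isSelfAdjoint_iff_isSymmetric]
  intro x y
  change ⟪amplification ι b x, y⟫_ℂ = ⟪x, amplification ι b y⟫_ℂ
  rw [lp.inner_eq_tsum, lp.inner_eq_tsum]
  exact tsum_congr fun i => hb.isSymmetric (x i) (y i)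

/-- Amplification preserves membership in the bicommutant. -/
theorem commute_amplification {ι : Type*} {b x : H →L[ℂ] H}
    (hx : ∀ z : H →L[ℂ] H, Commute b z → Commute x z)
    {p : lp (fun _ : ι => H) 2 →L[ℂ] lp (fun _ : ι => H) 2}
    (hp : Commute (amplification ι b) p) : Commute (amplification ι x) p := by
  classical
  -- Each matrix entry `q` of `p` commutes with `b`, hence with `x`.
  have hentry : ∀ i j v, x (p (lp.single 2 j v) i) = p (lp.single 2 j (x v)) i := by
    intro i j v
    let q : H →L[ℂ] H := (lp.evalCLM ℂ (fun _ : ι => H) 2 i).comp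
      (p.comp (lp.singleContinuousLinearMap ℂ (fun _ : ι => H) 2 j))
    have hq : ∀ v, q v = p (lp.single 2 j v) i := fun _ => rfl
    have hc : Commute b q := by
      ext v
      change b (q v) = q (b v)
      rw [hq, hq, ← amplification_single, ← amplification_apply]
      exact congrArg (fun u => u i) (DFunLike.congr_fun hp.eq (lp.single 2 j v))
    exact DFunLike.congr_fun (hx q hc).eq v
  refine ContinuousLinearMap.ext fun y => ?_
  -- Vectors supported at one index span a dense subspace, so the entrywise identity suffices.
  have hy := lp.hasSum_single (by simp) y
  have h1 := hy.mapL (amplification ι x * p)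
  have h2 := hy.mapL (p * amplification ι x)
  refine h1.unique ?_
  convert h2 using 2 with j
  ext i
  change x (p (lp.single 2 j (y j)) i) = p (amplification ι x (lp.single 2 j (y j))) i
  rw [amplification_single, hentry]

/-- A self-adjoint operator's bicommutant lies in the strong closure of its polynomials. -/
theorem apply_mem_closure_aeval [CompleteSpace H] {b x : H →L[ℂ] H} (hb : IsSelfAdjoint b)
    (hx : ∀ z : H →L[ℂ] H, Commute b z → Commute x z) (y : H) :
    x y ∈ closure (Set.range fun q : Polynomial ℂ => Polynomial.aeval b q y) := by
  let V : Submodule ℂ H := LinearMap.range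
    ((ContinuousLinearMap.apply ℂ H y).toLinearMap ∘ₗ (Polynomial.aeval b).toLinearMap)
  have hV : (V : Set H) = Set.range fun q : Polynomial ℂ => Polynomial.aeval b q y := rfl
  let M := V.topologicalClosure
  have hM : (M : Set H) = closure V := rfl
  have hMc : IsClosed (M : Set H) := V.isClosed_topologicalClosure
  have : CompleteSpace M := hMc.completeSpace_coe
  have hbM : ∀ v ∈ M, b v ∈ M := by
    intro v hv
    refine map_mem_closure b.continuous hv ?_
    rintro _ ⟨q, rfl⟩
    refine ⟨Polynomial.X * q, ?_⟩
    simp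
  -- Self-adjointness makes the complement of the cyclic subspace invariant too, so the projection
  -- onto it commutes with `b` and therefore with `x`.
  have hbM' : ∀ v ∈ Mᗮ, b v ∈ Mᗮ := by
    intro v hv u hu
    refine (hb.isSymmetric u v).symm.trans ?_
    exact hv _ (hbM u hu)
  have hc : Commute b M.starProjection := by
    ext v
    change b (M.starProjection v) = M.starProjection (b v)
    refine (Submodule.eq_starProjection_of_mem_of_inner_eq_zero (hbM _ (by simp)) ?_).symm
    intro w hw
    rw [← map_sub]
    exact (Submodule.mem_orthogonal' _ _).1
      (hbM' _ (Submodule.sub_starProjection_mem_orthogonal v)) w hw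
  -- The polynomial 1 puts y in M; then x y = x P y = P x y lies in M.
  have hy : y ∈ M := V.le_topologicalClosure ⟨1, by simp⟩
  have h := DFunLike.congr_fun (hx _ hc).eq y
  change x (M.starProjection y) = M.starProjection (x y) at h
  rw [Submodule.starProjection_eq_self_iff.2 hy] at h
  rw [← hV, ← hM, h]
  exact M.starProjection_apply_mem _

end Density

/-! ### Ultraweak density -/

section UltraweakDensity

variable {H : Type*} [NormedAddCommGroup H] [InnerProductSpace ℂ H] [CompleteSpace H]

theorem mem_vonNeumannGenerated_iff {b : H →L[ℂ] H} (hb : IsSelfAdjoint b) {x : H →L[ℂ] H} :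
    x ∈ vonNeumannGenerated b ↔ ∀ z : H →L[ℂ] H, Commute b z → Commute x z := by
  have h1 : ∀ z, z ∈ StarSubalgebra.centralizer ℂ ({b} : Set (H →L[ℂ] H)) ↔ Commute b z := by
    intro z
    rw [StarSubalgebra.mem_centralizer_iff]
    simp [hb.star_eq, Commute, SemiconjBy]
  change x ∈ StarSubalgebra.centralizer ℂ
    (StarSubalgebra.centralizer ℂ ({b} : Set (H →L[ℂ] H)) : Set (H →L[ℂ] H)) ↔ _
  rw [StarSubalgebra.mem_centralizer_iff]
  refine ⟨fun h z hz => (h z ((h1 z).2 hz)).1.symm, fun h z hz => ⟨?_, ?_⟩⟩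
  · exact (h z ((h1 z).1 hz)).symm.eq
  · exact (h _ ((h1 _).1 (star_mem hz))).symm.eq

theorem self_mem_vonNeumannGenerated {b : H →L[ℂ] H} (hb : IsSelfAdjoint b) :
    b ∈ vonNeumannGenerated b :=
  (mem_vonNeumannGenerated_iff hb).2 fun _ hz => hz

/-- The ultraweakly continuous functional `a ↦ ∑ₙ ⟪xₙ, a yₙ⟫`. -/
noncomputable def ultraweakFunctional (p : lp (fun _ : ℕ => H) 2 × lp (fun _ : ℕ => H) 2)
    (a : H →L[ℂ] H) : ℂ :=
  ∑' n, ⟪p.1 n, a (p.2 n)⟫_ℂ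

/-- On the amplified space an ultraweak functional is a single matrix coefficient, so strong
approximation there yields ultraweak approximation on H. -/
theorem ultraweakFunctional_eq_inner (p : lp (fun _ : ℕ => H) 2 × lp (fun _ : ℕ => H) 2)
    (a : H →L[ℂ] H) : ultraweakFunctional p a = ⟪p.1, amplification ℕ a p.2⟫_ℂ :=
  (lp.inner_eq_tsum (𝕜 := ℂ) p.1 (amplification ℕ a p.2)).symm

/-- Sequences supported at index 0 show that weak-operator functionals are ultraweak. -/
theorem ultraweakFunctional_single (u v : H) (a : H →L[ℂ] H) :
    ultraweakFunctional (lp.single 2 0 u, lp.single 2 0 v) a = ⟪u, a v⟫_ℂ := by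
  rw [ultraweakFunctional_eq_inner, amplification_single, lp.inner_single_left]
  simp

/-- In this form a basic neighbourhood constrains only finitely many functionals. -/
theorem ultraweakTopology_eq_induced :
    ultraweakTopology H =
      TopologicalSpace.induced (fun (a : H →L[ℂ] H) p => ultraweakFunctional p a) inferInstance := by
  simp only [ultraweakTopology, Pi.topologicalSpace, induced_iInf, induced_compose]
  rfl

theorem continuous_ultraweakFunctional
    (p : lp (fun _ : ℕ => H) 2 × lp (fun _ : ℕ => H) 2) :
    Continuous[ultraweakTopology H, inferInstance] (ultraweakFunctional p) := by
  rw [ultraweakTopology_eq_induced]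
  exact @Continuous.comp _ _ _ (_) _ _ _ _ (continuous_apply (A := fun _ => ℂ) p)
    (@continuous_induced_dom _ _ (fun (a : H →L[ℂ] H) p => ultraweakFunctional p a) _)

/-- Amplifying over ℕ handles one functional; amplifying again over the finite set `I` stacks all
the vectors `p.2` into one, so a single polynomial serves every functional. -/
theorem exists_aeval_ultraweakFunctional_mem {b x : H →L[ℂ] H} (hb : IsSelfAdjoint b)
    (hx : x ∈ vonNeumannGenerated b)
    (I : Finset (lp (fun _ : ℕ => H) 2 × lp (fun _ : ℕ => H) 2))
    {t : lp (fun _ : ℕ => H) 2 × lp (fun _ : ℕ => H) 2 → Set ℂ}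
    (ht : ∀ p ∈ I, t p ∈ 𝓝 (ultraweakFunctional p x)) :
    ∃ q : Polynomial ℂ, ∀ p ∈ I, ultraweakFunctional p (Polynomial.aeval b q) ∈ t p := by
  let y : lp (fun _ : I => lp (fun _ : ℕ => H) 2) 2 := ⟨fun k => k.1.2, Memℓp.all _⟩
  have hcl := apply_mem_closure_aeval
    (isSelfAdjoint_amplification (ι := I) (isSelfAdjoint_amplification (ι := ℕ) hb))
    (fun z hz => commute_amplification (fun z hz => commute_amplification
      ((mem_vonNeumannGenerated_iff hb).1 hx) hz) hz) y
  have hnhds : ∀ᶠ z in 𝓝 (amplification I (amplification ℕ x) y),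
      ∀ k : I, ⟪k.1.1, z k⟫_ℂ ∈ t k.1 := by
    rw [Filter.eventually_all]
    intro k
    have hcont : Continuous fun z : lp (fun _ : I => lp (fun _ : ℕ => H) 2) 2 =>
        ⟪k.1.1, z k⟫_ℂ :=
      continuous_const.inner (lp.evalCLM ℂ (fun _ : I => lp (fun _ : ℕ => H) 2) 2 k).continuous
    refine hcont.continuousAt ?_
    have := ht k.1 k.2
    rwa [ultraweakFunctional_eq_inner] at this
  obtain ⟨_, hz, q, rfl⟩ := mem_closure_iff_nhds.1 hcl _ hnhds
  refine ⟨q, fun p hp => ?_⟩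
  have h := hz ⟨p, hp⟩
  simp only [aeval_amplification] at h
  rwa [ultraweakFunctional_eq_inner]

/-- The polynomials of a self-adjoint operator are ultraweakly dense in its bicommutant. -/
theorem mem_ultraweak_closure_aeval {b x : H →L[ℂ] H} (hb : IsSelfAdjoint b)
    (hx : x ∈ vonNeumannGenerated b) :
    x ∈ @closure _ (ultraweakTopology H)
      (Set.range fun q : Polynomial ℂ => Polynomial.aeval b q) := by
  rw [ultraweakTopology_eq_induced, closure_induced, mem_closure_iff_nhds]
  intro U hU
  rw [nhds_pi, Filter.mem_pi'] at hU
  obtain ⟨I, t, ht, htU⟩ := hU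
  obtain ⟨q, hq⟩ := exists_aeval_ultraweakFunctional_mem hb hx I fun p _ => ht p
  exact ⟨_, htU hq, _, ⟨q, rfl⟩, rfl⟩

/-- Ultraweakly continuous functions on a von Neumann algebra that agree on the polynomials of
`b` agree on `b''`. -/
theorem eqOn_vonNeumannGenerated {S : VonNeumannAlgebra H} {b : S}
    (hb : IsSelfAdjoint (b : H →L[ℂ] H)) {f g : S → ℂ}
    (hf : Continuous[.induced Subtype.val (ultraweakTopology H), inferInstance] f)
    (hg : Continuous[.induced Subtype.val (ultraweakTopology H), inferInstance] g)
    (hfg : ∀ q : Polynomial ℂ, f (Polynomial.aeval b q) = g (Polynomial.aeval b q))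
    {x : S} (hx : (x : H →L[ℂ] H) ∈ vonNeumannGenerated (b : H →L[ℂ] H)) : f x = g x := by
  have hcl : x ∈ @closure _ (.induced Subtype.val (ultraweakTopology H))
      (Set.range fun q : Polynomial ℂ => Polynomial.aeval b q) := by
    rw [@closure_induced _ _ (ultraweakTopology H), ← Set.range_comp]
    convert mem_ultraweak_closure_aeval hb hx using 3
    funext q
    exact (Polynomial.aeval_algHom_apply S.toStarSubalgebra.subtype.toAlgHom b q).symm
  let : TopologicalSpace S := .induced Subtype.val (ultraweakTopology H)
  exact closure_minimal (t := {x | f x = g x}) (Set.range_subset_iff.2 hfg)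
    (isClosed_eq hf hg) hcl

theorem continuous_ultraweak_mul_right (c : H →L[ℂ] H) :
    Continuous[ultraweakTopology H, ultraweakTopology H] fun a => a * c := by
  -- The factor `c` is absorbed into the second vector of the functional.
  refine continuous_iInf_rng.2 fun p => continuous_induced_rng.2 ?_
  exact continuous_ultraweakFunctional (p.1, amplification ℕ c p.2)

end UltraweakDensity

/-! ### Borel functions of an operator -/

section BorelIdentity

variable {H : Type*} [NormedAddCommGroup H] [InnerProductSpace ℂ H] [CompleteSpace H]
  {b : H →L[ℂ] H}

theorem borelFunction_coe (hb : IsSelfAdjoint b)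
    (hf : Measurable fun t : spectrum ℝ b => ((t : ℝ) : ℂ))
    (hfb : ∃ M, ∀ t : spectrum ℝ b, ‖((t : ℝ) : ℂ)‖ ≤ M) :
    borelFunction hb (fun t => ((t : ℝ) : ℂ)) hf hfb = b := by
  refine ContinuousLinearMap.coe_injective ((ext_inner_map _ _).1 fun x => ?_)
  have h := inner_borelFunction hb hf hfb x
  replace h := h.trans (integral_complex_ofReal.trans
    (integral_vectorMeasure hb x ⟨fun t => (t : ℝ), continuous_subtype_val⟩))
  have hid : cfcHom hb ⟨fun t => (t : ℝ), continuous_subtype_val⟩ = b := cfcHom_id hb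
  rw [hid] at h
  -- `ext_inner_map` has the operator in the first slot of the inner product.
  have := congrArg (starRingEnd ℂ) h
  rwa [inner_conj_symm, inner_conj_symm] at this

end BorelIdentity

/-! ### The main theorem -/

section AddedVarianceTheorem

variable {H K : Type*} [NormedAddCommGroup H] [InnerProductSpace ℂ H] [CompleteSpace H]
  [NormedAddCommGroup K] [InnerProductSpace ℂ K] [CompleteSpace K]
  {𝓑 : VonNeumannAlgebra H} {𝓐 : VonNeumannAlgebra K}

theorem map_star_mul_of_varianceForm_eq_zero {T : 𝓑 →CP 𝓐} (hT : T 1 = 1) {X : 𝓑}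
    (hX : varianceForm T X X = 0) (Y : 𝓑) : T (star X * Y) = star (T X) * T Y :=
  T.map_star_mul_of_variance_eq_zero hT (sub_eq_zero.1 hX) Y

theorem map_mul_comm_of_varianceForm_eq_zero {T : 𝓑 →CP 𝓐} (hT : T 1 = 1) {B : 𝓑}
    (hB : IsSelfAdjoint B) (h : varianceForm T B B = 0) (Y : 𝓑) :
    T (B * Y) = T B * T Y ∧ T (Y * B) = T Y * T B := by
  have hTB : star (T B) = T B := by rw [← T.map_star_apply, hB.star_eq]
  have h1 : ∀ Y, T (B * Y) = T B * T Y := fun Y => by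
    have := map_star_mul_of_varianceForm_eq_zero hT h Y
    rwa [hB.star_eq, hTB] at this
  refine ⟨h1 Y, ?_⟩
  -- The right-hand rule is the adjoint of the left-hand rule.
  have h2 := congrArg star (h1 (star Y))
  rw [← T.map_star_apply] at h2
  simpa [T.map_star_apply, hB.star_eq, hTB] using h2

theorem map_aeval_mul {T : 𝓑 →CP 𝓐} {B : 𝓑} (hT : T 1 = 1)
    (h : ∀ Y, T (B * Y) = T B * T Y) (q : Polynomial ℂ) :
    T (Polynomial.aeval B q) = Polynomial.aeval (T B) q ∧
      ∀ Y, T (Polynomial.aeval B q * Y) = Polynomial.aeval (T B) q * T Y := by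
  -- The free factor Y drives the induction on powers; Y = 1 then gives the first claim.
  have key : ∀ Y, T (Polynomial.aeval B q * Y) = Polynomial.aeval (T B) q * T Y := by
    induction q using Polynomial.induction_on' with
    | add p q hp hq => intro Y; simp [add_mul, hp, hq]
    | monomial n c =>
      have hpow : ∀ Y, T (B ^ n * Y) = T B ^ n * T Y := by
        induction n with
        | zero => simp
        | succ n ih => intro Y; rw [pow_succ', pow_succ', mul_assoc, h, ih, mul_assoc]
      intro Y
      simp [Polynomial.aeval_monomial, Algebra.algebraMap_eq_smul_one, hpow]
  refine ⟨?_, key⟩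
  simpa [hT] using key 1

theorem continuous_inner_map {T : 𝓑 →CP 𝓐} (hTc : IsUltraweaklyContinuous T) (u v : K) :
    Continuous[TopologicalSpace.induced Subtype.val (ultraweakTopology H), inferInstance]
      fun X : 𝓑 => ⟪u, (T X : K →L[ℂ] K) v⟫_ℂ := by
  let := ultraweakTopology H
  let := ultraweakTopology K
  let : TopologicalSpace 𝓑 := TopologicalSpace.induced Subtype.val (ultraweakTopology H)
  let : TopologicalSpace 𝓐 := TopologicalSpace.induced Subtype.val (ultraweakTopology K)
  have h := (continuous_ultraweakFunctional (lp.single 2 0 u, lp.single 2 0 v)).comp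
    (continuous_induced_dom.comp hTc)
  refine h.congr fun X => ?_
  exact ultraweakFunctional_single u v _

theorem continuous_mul_right_induced (Y : 𝓑) :
    Continuous[TopologicalSpace.induced Subtype.val (ultraweakTopology H),
      TopologicalSpace.induced Subtype.val (ultraweakTopology H)] fun X : 𝓑 => X * Y := by
  let := ultraweakTopology H
  let : TopologicalSpace 𝓑 := TopologicalSpace.induced Subtype.val (ultraweakTopology H)
  exact continuous_induced_rng.2
    ((continuous_ultraweak_mul_right (Y : H →L[ℂ] H)).comp continuous_induced_dom)

theorem restrictsToStarHom_of_varianceForm_eq_zero {T : 𝓑 →CP 𝓐} (hT : T 1 = 1)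
    (hTc : IsUltraweaklyContinuous T) {B : 𝓑} (hB : IsSelfAdjoint (B : H →L[ℂ] H))
    (h : varianceForm T B B = 0) : RestrictsToStarHom T B := by
  have hB' : IsSelfAdjoint B := Subtype.ext hB
  have hTB' : IsSelfAdjoint (T B) := by
    rw [IsSelfAdjoint, ← T.map_star_apply, hB'.star_eq]
  have hTB : IsSelfAdjoint (T B : K →L[ℂ] K) := congrArg Subtype.val hTB'
  have hpoly := map_aeval_mul hT fun Y => (map_mul_comm_of_varianceForm_eq_zero hT hB' h Y).1
  -- Only X is approximated by polynomials; Y stays fixed and arbitrary, so separate continuity of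
  -- the product suffices.
  have hmul : ∀ X Y : 𝓑, (X : H →L[ℂ] H) ∈ vonNeumannGenerated (B : H →L[ℂ] H) →
      T (X * Y) = T X * T Y := by
    intro X Y hX
    refine Subtype.ext (ContinuousLinearMap.ext fun v => ext_inner_left ℂ fun u => ?_)
    refine eqOn_vonNeumannGenerated hB
      (f := (fun X : 𝓑 => ⟪u, (T X : K →L[ℂ] K) v⟫_ℂ) ∘ fun X => X * Y)
      (g := fun X : 𝓑 => ⟪u, (T X : K →L[ℂ] K) ((T Y : K →L[ℂ] K) v)⟫_ℂ)
      (@Continuous.comp _ _ _ (_) (_) _ _ _ (continuous_inner_map hTc u v)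
        (continuous_mul_right_induced Y))
      (continuous_inner_map hTc u _) (fun q => ?_) hX
    simp only [Function.comp_apply, (hpoly q).1, (hpoly q).2]
    rfl
  have hmem : ∀ X : 𝓑, (X : H →L[ℂ] H) ∈ vonNeumannGenerated (B : H →L[ℂ] H) →
      (T X : K →L[ℂ] K) ∈ vonNeumannGenerated (T B : K →L[ℂ] K) := by
    intro X hX
    refine (mem_vonNeumannGenerated_iff hTB).2 fun z hz => ?_
    refine ContinuousLinearMap.ext fun v => ext_inner_left ℂ fun u => ?_
    change ⟪u, (T X : K →L[ℂ] K) (z v)⟫_ℂ = ⟪u, z ((T X : K →L[ℂ] K) v)⟫_ℂ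
    -- With z moved onto u, both sides are matrix coefficients of T(X), hence ultraweakly continuous
    -- in X.
    rw [← ContinuousLinearMap.adjoint_inner_left z]
    refine eqOn_vonNeumannGenerated hB
      (continuous_inner_map hTc u (z v)) (continuous_inner_map hTc (z.adjoint u) v)
      (fun q => ?_) hX
    have hc : Commute (Polynomial.aeval (T B) q : K →L[ℂ] K) z := by
      have hq : ((Polynomial.aeval (T B) q : 𝓐) : K →L[ℂ] K) =
          Polynomial.aeval (T B : K →L[ℂ] K) q :=
        (Polynomial.aeval_algHom_apply 𝓐.toStarSubalgebra.subtype.toAlgHom (T B) q).symm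
      rw [hq]
      clear hq
      induction q using Polynomial.induction_on' with
      | add p q hp hq => simpa using hp.add_left hq
      | monomial n c =>
        rw [Polynomial.aeval_monomial]
        exact Commute.mul_left (Algebra.commutes c z) (hz.pow_left n)
    rw [(hpoly q).1, ContinuousLinearMap.adjoint_inner_left]
    exact congrArg (fun w => ⟪u, w⟫_ℂ) (DFunLike.congr_fun hc.eq v)
  let ι : vonNeumannGenerated (B : H →L[ℂ] H) → 𝓑 :=
    fun x => ⟨x, vonNeumannGenerated_le 𝓑 B.2 x.2⟩
  let φ : vonNeumannGenerated (B : H →L[ℂ] H) → vonNeumannGenerated (T B : K →L[ℂ] K) :=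
    fun x => ⟨T (ι x), hmem (ι x) x.2⟩
  have hφ : ∀ {x z}, (T (ι x) : K →L[ℂ] K) = z → (φ x : K →L[ℂ] K) = z := id
  have hT' : ∀ {X Y : 𝓐}, X = Y → (X : K →L[ℂ] K) = Y := congrArg Subtype.val
  exact ⟨{
    toFun := φ
    map_one' := Subtype.ext (hφ (hT' hT))
    map_mul' := fun x y => Subtype.ext (hφ (hT' (hmul (ι x) (ι y) x.2)))
    map_zero' := Subtype.ext (hφ (hT' (map_zero T)))
    map_add' := fun x y => Subtype.ext (hφ (hT' (map_add T (ι x) (ι y))))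
    commutes' := fun c => Subtype.ext (hφ (hT' (show T (algebraMap ℂ 𝓑 c) = algebraMap ℂ 𝓐 c by
      rw [Algebra.algebraMap_eq_smul_one, map_smul, hT, Algebra.algebraMap_eq_smul_one])))
    map_star' := fun x => Subtype.ext (hφ (hT' (T.map_star_apply (ι x)))) },
    fun x => rfl⟩

/-- Allowing any X in B'' covers both X = B and X = f(B). -/
theorem RestrictsToStarHom.varianceForm_eq_zero {T : 𝓑 →CP 𝓐} {B X : 𝓑}
    (h : RestrictsToStarHom T B)
    (hX : (X : H →L[ℂ] H) ∈ vonNeumannGenerated (B : H →L[ℂ] H)) : varianceForm T X X = 0 := by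
  obtain ⟨φ, hφ⟩ := h
  let x : vonNeumannGenerated (B : H →L[ℂ] H) := ⟨X, hX⟩
  refine sub_eq_zero.2 (Subtype.ext ?_)
  have h1 := congrArg Subtype.val ((map_mul φ (star x) x).trans (by rw [map_star]))
  have h2 := hφ x
  calc ((T (star X * X) : 𝓐) : K →L[ℂ] K) = φ (star x * x) := (hφ (star x * x)).symm
    _ = star (φ x : K →L[ℂ] K) * φ x := h1
    _ = star (T X : K →L[ℂ] K) * T X := by rw [h2]

end AddedVarianceTheorem

theorem theorem1 {H K : Type*} [NormedAddCommGroup H] [InnerProductSpace ℂ H] [CompleteSpace H]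
    [NormedAddCommGroup K] [InnerProductSpace ℂ K] [CompleteSpace K]
    (𝓑 : VonNeumannAlgebra H) (𝓐 : VonNeumannAlgebra K)
    (T : 𝓑 →CP 𝓐) (hT₁ : T 1 = 1) (hTc : IsUltraweaklyContinuous T)
    (B : 𝓑) (hB : IsSelfAdjoint (B : H →L[ℂ] H)) :
    (varianceForm T B B = 0 ↔ RestrictsToStarHom T B) ∧
    (RestrictsToStarHom T B ↔
      ∀ (f : spectrum ℝ (B : H →L[ℂ] H) → ℂ) (hf : Measurable f) (hfb : ∃ M, ∀ t, ‖f t‖ ≤ M),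
        varianceForm T (applyBorel B hB f hf hfb) (applyBorel B hB f hf hfb) = 0) ∧
    (varianceForm T B B = 0 →
      Set.MapsTo T (Set.centralizer {B}) (Set.centralizer {T B})) := by
  have h12 : varianceForm T B B = 0 → RestrictsToStarHom T B :=
    restrictsToStarHom_of_varianceForm_eq_zero hT₁ hTc hB
  refine ⟨⟨h12, fun h => h.varianceForm_eq_zero (self_mem_vonNeumannGenerated hB)⟩,
    ⟨fun h f hf hfb => h.varianceForm_eq_zero
      (borelFunction_mem _ (self_mem_vonNeumannGenerated hB) hB hf hfb), fun h => h12 ?_⟩, ?_⟩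
  -- The test function is f(t) = t, bounded because the spectrum is compact.
  · have hf : Continuous fun t : spectrum ℝ (B : H →L[ℂ] H) => ((t : ℝ) : ℂ) := by fun_prop
    have hfb : ∃ M, ∀ t : spectrum ℝ (B : H →L[ℂ] H), ‖((t : ℝ) : ℂ)‖ ≤ M := by
      obtain ⟨M, hM⟩ := isCompact_univ.exists_bound_of_continuousOn hf.continuousOn
      exact ⟨M, fun t => hM t trivial⟩
    have hB' : applyBorel B hB _ hf.measurable hfb = B :=
      Subtype.ext (borelFunction_coe hB hf.measurable hfb)
    have := h _ hf.measurable hfb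
    rwa [hB'] at this
  · intro h X hX
    rw [Set.mem_centralizer_iff] at hX ⊢
    rintro _ rfl
    -- T(B)T(X) = T(BX) = T(XB) = T(X)T(B).
    obtain ⟨h1, h2⟩ := map_mul_comm_of_varianceForm_eq_zero hT₁ (Subtype.ext hB) h X
    rw [← h1, ← h2, hX B rfl]
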